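/- For an integer $n\ge 1$, a real number $q$ and $\mathbf x\in\{0,1\}^n$ write $|\mathbf x|=\sum_{i=1}^n x_i$. Let $\mathrm{MK}(q)$ be the unweighted minimum knapsack problem \[ \min\ |\mathbf x|\quad\text{s.t.}\quad |\mathbf x|\ge q,\quad \mathbf x\in\{0,1\}^n , \] with optimal value $f^*$. For an integer $d\ge 0$, let $f^d_\Sigma$ be the supremum of all $\lambda\in\mathbb R$ for which there are sums of squares of polynomials $s_0,s_1\in\mathbb R[x_1,\dots,x_n]$ with $\deg(s_0)\le 2d+2$, $\deg(s_1)\le 2d$ and \[ |\mathbf x|-\lambda=s_0(\mathbf x)+s_1(\mathbf x)\,(|\mathbf x|-q)\qquad\text{for all }\mathbf x\in\{0,1\}^n . \] The SOS rank of $\mathrm{MK}(q)$ is the smallest integer $d\ge0$ with $f^d_\Sigma=f^*$. Theorem. For $0<q<n$ with fractional part $\widehat q=q-\lfloor q\rfloor\neq 0$, the SOS rank of $\mathrm{MK}(q)$ is $\Omega(\min\{\lceil q\rceil,\,n-\lfloor q\rfloor\})$. That is, there is an absolute constant $c>0$ such that for every integer $n\ge1$ and every non-integral real $q$ with $0<q<n$,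 the SOS rank of $\mathrm{MK}(q)$ is at least $c\cdot\min\{\lceil q\rceil,\,n-\lfloor q\rfloor\}$. -/

import Mathlib

noncomputable section

namespace MinKnapsack

/-- The Boolean hypercube `{0,1}^n`, as a set of real vectors. -/
def cube (n : ℕ) : Set (Fin n → ℝ) :=
  {x | ∀ i, x i = 0 ∨ x i = 1}

/-- The Hamming weight `|x| = x₁ + ⋯ + xₙ`. -/
def weight {n : ℕ} (x : Fin n → ℝ) : ℝ :=
  ∑ i, x i

/-- The optimal value of `MK(q)`: minimize `|x|` subject to `|x| ≥ q` and `x ∈ {0,1}^n`.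
It is `+∞` if the problem is infeasible. -/
def optVal (n : ℕ) (q : ℝ) : EReal :=
  ⨅ x ∈ {x : Fin n → ℝ | x ∈ cube n ∧ q ≤ weight x}, ((weight x : ℝ) : EReal)

/-- `v` is feasible for the degree-`d` sum-of-squares program of `MK(q)`: there are sums of squares
of polynomials `s₀, s₁ ∈ ℝ[x₁, …, xₙ]` with `deg s₀ ≤ 2d + 2`, `deg s₁ ≤ 2d` and
`|x| - v = s₀(x) + s₁(x) (|x| - q)` on the Boolean hypercube. -/
def SOSFeasible (n : ℕ) (q : ℝ) (d : ℕ) (v : ℝ) : Prop :=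
  ∃ s₀ s₁ : MvPolynomial (Fin n) ℝ,
    IsSumSq s₀ ∧ IsSumSq s₁ ∧
    s₀.totalDegree ≤ 2 * d + 2 ∧ s₁.totalDegree ≤ 2 * d ∧
    ∀ x ∈ cube n,
      weight x - v = MvPolynomial.eval x s₀ + MvPolynomial.eval x s₁ * (weight x - q)

/-- The value of the degree-`d` sum-of-squares program of `MK(q)`. -/
def sosVal (n : ℕ) (q : ℝ) (d : ℕ) : EReal :=
  ⨆ v ∈ {v : ℝ | SOSFeasible n q d v}, (v : EReal)

/-- The SOS rank of `MK(q)`: the least `d` such that the degree-`d` program is exact.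
(Some degree is always exact; the value `0` that `sInf ∅` would give can only make a lower bound
on the rank harder.) -/
def sosRank (n : ℕ) (q : ℝ) : ℕ :=
  sInf {d : ℕ | sosVal n q d = optVal n q}

end MinKnapsack

end

/-! The value of a low-degree program stays at most `q`, while the optimum is `⌈q⌉ > q`. The witness
is a pseudo-expectation `E` that behaves as if `|x| = q` held exactly: `E 1 = 1`, `E` kills `(q -
|x|) g` for `deg g < n` (`pseudoExp_gap_mul`), and `E` is nonnegative on squares of low degree
(`pseudoExp_sq_nonneg`). Applying `E` to `s₀ = (q - v) + (q - |x|)(s₁ - 1)` gives `0 ≤ E s₀ = q -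
v`.

For positivity, the relation `|x| = q` makes any polynomial homogeneous of top degree `D`. On
monomials of size `D`, the Gram matrix entry `E (x_A x_B)` depends only on `|A ∩ B|`. Splitting on
the values of that many further coordinates writes it as a sum over `K ⊆ A ∩ B` of
pseudo-probabilities. So the matrix is a combination of the rank-one matrices `[K ⊆ A][K ⊆ B]`,
whose coefficients are nonnegative when `2D ≤ q + 1` and `D ≤ n - q + 1`. -/

namespace MinKnapsack

/-! ### Pseudo-probabilities -/

/-- The number `t (t - 1) ⋯ (t - a + 1) (n - t) ⋯ (n - t - b + 1) / (n (n - 1) ⋯ (n - a - b + 1))`,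
the pseudo-probability that `a` given coordinates are `1` and `b` others are `0`. -/
noncomputable def pseudoProb (n : ℕ) (t : ℝ) (a b : ℕ) : ℝ :=
  (∏ i ∈ Finset.range a, (t - i)) * (∏ i ∈ Finset.range b, (n - t - i)) /
    ∏ i ∈ Finset.range (a + b), ((n : ℝ) - i)

theorem prod_range_sub_ne_zero {n k : ℕ} (h : k ≤ n) :
    ∏ i ∈ Finset.range k, ((n : ℝ) - i) ≠ 0 := by
  refine Finset.prod_ne_zero_iff.2 fun i hi => ?_
  have : (i : ℝ) < n := by exact_mod_cast (Finset.mem_range.1 hi).trans_le h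
  linarith

/-- One more coordinate is `1` or `0`; the identity is `(t - a) + (n - t - b) = n - a - b`. -/
theorem pseudoProb_split {n : ℕ} (t : ℝ) {a b : ℕ} (h : a + b < n) :
    pseudoProb n t a b = pseudoProb n t (a + 1) b + pseudoProb n t a (b + 1) := by
  have h1 := prod_range_sub_ne_zero h.le
  have h2 : (n : ℝ) - (a + b : ℕ) ≠ 0 := by
    have : ((a + b : ℕ) : ℝ) < n := by exact_mod_cast h
    linarith
  have e : a + 1 + b = a + b + 1 := by omega
  unfold pseudoProb
  rw [e, ← add_assoc a b 1, Finset.prod_range_succ (fun i : ℕ => (n : ℝ) - i),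
    Finset.prod_range_succ (fun i : ℕ => t - i),
    Finset.prod_range_succ (fun i : ℕ => (n : ℝ) - t - i)]
  field_simp
  push_cast
  ring

/-- Reveal `s` further coordinates; `j` counts those equal to `0`. -/
theorem pseudoProb_expand {n : ℕ} (t : ℝ) (s : ℕ) : ∀ a b : ℕ, a + b + s ≤ n →
    pseudoProb n t a b =
      ∑ j ∈ Finset.range (s + 1), (s.choose j : ℝ) * pseudoProb n t (a + s - j) (b + j) := by
  induction s with
  | zero => intro a b _; simp
  | succ s ih =>
    intro a b h
    rw [pseudoProb_split t (by omega), ih (a + 1) b (by omega), ih a (b + 1) (by omega)]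
    rw [Finset.sum_range_succ' _ (s + 1)]
    have e1 : ∑ j ∈ Finset.range (s + 1), ((s + 1).choose (j + 1) : ℝ) *
          pseudoProb n t (a + (s + 1) - (j + 1)) (b + (j + 1)) =
        ∑ j ∈ Finset.range (s + 1), (s.choose j : ℝ) * pseudoProb n t (a + s - j) (b + 1 + j) +
        ∑ j ∈ Finset.range (s + 1), (s.choose (j + 1) : ℝ) *
          pseudoProb n t (a + 1 + s - (j + 1)) (b + (j + 1)) := by
      rw [← Finset.sum_add_distrib]
      refine Finset.sum_congr rfl fun j _ => ?_
      rw [Nat.choose_succ_succ, show a + (s + 1) - (j + 1) = a + s - j by omega,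
        show a + 1 + s - (j + 1) = a + s - j by omega, show b + 1 + j = b + (j + 1) by omega]
      push_cast; ring
    rw [e1, Finset.sum_range_succ' _ s, Finset.sum_range_succ (fun j =>
      (s.choose (j + 1) : ℝ) * pseudoProb n t (a + 1 + s - (j + 1)) (b + (j + 1))) s]
    simp only [Nat.choose_succ_self, Nat.choose_zero_right, Nat.cast_zero, zero_mul, add_zero,
      Nat.sub_zero, show a + 1 + s = a + (s + 1) by omega]
    ring

theorem pseudoProb_nonneg {n : ℕ} {t : ℝ} {a b : ℕ} (hn : a + b ≤ n) (ha : (a : ℝ) ≤ t + 1)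
    (hb : (b : ℝ) ≤ n - t + 1) : 0 ≤ pseudoProb n t a b := by
  unfold pseudoProb
  refine div_nonneg (mul_nonneg ?_ ?_) ?_ <;>
    refine Finset.prod_nonneg fun i hi => ?_ <;>
    have hi' := Nat.succ_le_of_lt (Finset.mem_range.1 hi)
  · have : ((i + 1 : ℕ) : ℝ) ≤ a := by exact_mod_cast hi'
    push_cast at this; linarith
  · have : ((i + 1 : ℕ) : ℝ) ≤ b := by exact_mod_cast hi'
    push_cast at this; linarith
  · have : ((i + 1 : ℕ) : ℝ) ≤ n := by exact_mod_cast hi'.trans hn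
    push_cast at this; linarith

/-! ### The pseudo-expectation and its values on monomials -/

/-- The monomial `∏_{i ∈ A} xᵢ` as a function of the support of `x ∈ {0,1}^n`. -/
def mono {n : ℕ} (A : Finset (Fin n)) : Finset (Fin n) → ℝ :=
  fun S => if A ⊆ S then 1 else 0

theorem mono_mul_mono {n : ℕ} (A B : Finset (Fin n)) : mono A * mono B = mono (A ∪ B) := by
  ext S
  by_cases h1 : A ⊆ S <;> by_cases h2 : B ⊆ S <;> simp [mono, h1, h2, Finset.union_subset_iff]

/-- The polynomial `t - |x|` as a function of the support of `x`. -/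
def gap (n : ℕ) (t : ℝ) : Finset (Fin n) → ℝ := fun S => t - S.card

theorem gap_mul_mono {n : ℕ} (t : ℝ) (A : Finset (Fin n)) :
    gap n t * mono A = (t - A.card) • mono A - ∑ j ∈ Aᶜ, mono (insert j A) := by
  ext S
  simp only [Pi.mul_apply, Pi.sub_apply, Pi.smul_apply, Finset.sum_apply, gap, mono, smul_eq_mul]
  by_cases h : A ⊆ S
  · have e : ∀ j, (insert j A ⊆ S) ↔ j ∈ S := fun j => by simp [Finset.insert_subset_iff, h]
    simp only [h, e, if_true, Finset.sum_boole]
    have : (Aᶜ.filter (· ∈ S)) = S \ A := by ext; simp [and_comm]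
    rw [this, Finset.cast_card_sdiff h]; ring
  · have e : ∀ j, ¬ insert j A ⊆ S := fun j hj => h ((Finset.subset_insert _ _).trans hj)
    simp [h, e]

/-- The pseudo-expectation at weight `t`: the signed measure on `{0,1}^n` with density
proportional to `(-1)^|x| / (t - |x|)`. -/
noncomputable def pseudoExp (n : ℕ) (t : ℝ) : (Finset (Fin n) → ℝ) →ₗ[ℝ] ℝ :=
  -- The scalar fixes the value on the full monomial as `pseudoProb n t n 0`.
  (pseudoProb n t n 0 * ((-1) ^ n * (t - n))) •
    ∑ S : Finset (Fin n), ((-1) ^ S.card / (t - S.card)) • LinearMap.proj S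

/-- Toggling a coordinate outside `A` is a sign-reversing involution. -/
theorem sum_neg_one_pow_mul_mono {n : ℕ} {A : Finset (Fin n)} (hA : A ≠ Finset.univ) :
    ∑ S : Finset (Fin n), (-1 : ℝ) ^ S.card * mono A S = 0 := by
  obtain ⟨j, hj⟩ : ∃ j, j ∉ A := by
    by_contra! h; exact hA (Finset.eq_univ_iff_forall.2 h)
  refine Finset.sum_involution (fun S _ => symmDiff S {j}) ?_ ?_ (by simp) (by simp)
  · intro S _
    have hm : mono A (symmDiff S {j}) = mono A S := by
      have : A ⊆ symmDiff S {j} ↔ A ⊆ S := by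
        constructor <;> intro h i hi <;> have := h hi <;>
          have hij : i ≠ j := (fun e => hj (e ▸ hi)) <;>
          simp_all [Finset.mem_symmDiff]
      simp [mono, this]
    rw [hm]
    by_cases h : j ∈ S
    · have : symmDiff S {j} = S.erase j := by
        ext i; by_cases e : i = j <;> simp_all [Finset.mem_symmDiff]
      rw [this, ← Finset.card_erase_add_one h, pow_succ]; ring
    · have : symmDiff S {j} = insert j S := by
        ext i; by_cases e : i = j <;> simp_all [Finset.mem_symmDiff]
      rw [this, Finset.card_insert_of_notMem h, pow_succ]; ring
  · intro S _ _ h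
    have := congrArg (j ∈ ·) h
    simp [Finset.mem_symmDiff] at this

/-- The factor `t - |x|` cancels the denominator of the density and leaves an alternating sum. -/
theorem pseudoExp_gap_mul_mono {n : ℕ} {t : ℝ} (ht : ∀ k : ℕ, t ≠ k) {A : Finset (Fin n)}
    (hA : A ≠ Finset.univ) : pseudoExp n t (gap n t * mono A) = 0 := by
  have : ∑ S : Finset (Fin n), (-1 : ℝ) ^ S.card / (t - S.card) * ((t - S.card) * mono A S) = 0 := by
    rw [← sum_neg_one_pow_mul_mono hA]
    refine Finset.sum_congr rfl fun S _ => ?_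
    have := sub_ne_zero.2 (ht S.card)
    field_simp
  simp [pseudoExp, gap, this]

theorem pseudoProb_succ {n : ℕ} (t : ℝ) {a : ℕ} (h : a < n) :
    ((n : ℝ) - a) * pseudoProb n t (a + 1) 0 = (t - a) * pseudoProb n t a 0 := by
  have h1 := prod_range_sub_ne_zero h.le
  have h2 : (n : ℝ) - a ≠ 0 := by
    have : (a : ℝ) < n := by exact_mod_cast h
    linarith
  simp only [pseudoProb, add_zero, Finset.prod_range_zero, mul_one,
    Finset.prod_range_succ _ a]
  field_simp

theorem pseudoExp_mono_univ {n : ℕ} {t : ℝ} (ht : ∀ k : ℕ, t ≠ k) :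
    pseudoExp n t (mono Finset.univ) = pseudoProb n t n 0 := by
  have e : ∀ S : Finset (Fin n), (-1 : ℝ) ^ S.card / (t - S.card) * mono Finset.univ S =
      if S = Finset.univ then (-1 : ℝ) ^ n / (t - n) else 0 := by
    intro S
    by_cases h : S = Finset.univ <;> simp [mono, h, Finset.univ_subset_iff]
  have h2 : t - n ≠ 0 := sub_ne_zero.2 (ht n)
  have h3 : ((-1 : ℝ) ^ n) * (-1) ^ n = 1 := by rw [← mul_pow]; simp
  simp only [pseudoExp, LinearMap.smul_apply, LinearMap.sum_apply, LinearMap.proj_apply,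
    smul_eq_mul, e, Finset.sum_ite_eq', Finset.mem_univ, if_true]
  field_simp
  linear_combination pseudoProb n t n 0 * h3

/-- Downward induction on `A.card`: the vanishing on `gap n t * mono A` determines the value at `A`
from those one size larger, as `t` is not an integer. -/
theorem pseudoExp_mono {n : ℕ} {t : ℝ} (ht : ∀ k : ℕ, t ≠ k) (A : Finset (Fin n)) :
    pseudoExp n t (mono A) = pseudoProb n t A.card 0 := by
  induction hk : n - A.card generalizing A with
  | zero =>
    have hA : A = Finset.univ := by
      rw [← Finset.card_eq_iff_eq_univ, Fintype.card_fin]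
      have := Finset.card_le_univ A
      rw [Fintype.card_fin] at this
      omega
    subst hA
    simpa using pseudoExp_mono_univ ht
  | succ k ih =>
    have hA : A ≠ Finset.univ := by rintro rfl; simp at hk
    have h := pseudoExp_gap_mul_mono ht hA
    rw [gap_mul_mono, map_sub, map_smul, map_sum, smul_eq_mul, Finset.sum_congr rfl
      (g := fun _ => pseudoProb n t (A.card + 1) 0)] at h
    · rw [Finset.sum_const, Finset.card_compl, Fintype.card_fin, nsmul_eq_mul,
        Nat.cast_sub (by omega), pseudoProb_succ t (by omega), ← mul_sub] at h
      exact sub_eq_zero.1 ((mul_eq_zero.1 h).resolve_left (sub_ne_zero.2 (ht _)))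
    · intro j hj
      have hc := Finset.card_insert_of_notMem (Finset.mem_compl.1 hj)
      rw [ih _ (by omega), hc]

theorem pseudoExp_one {n : ℕ} {t : ℝ} (ht : ∀ k : ℕ, t ≠ k) : pseudoExp n t 1 = 1 := by
  have : (1 : Finset (Fin n) → ℝ) = mono ∅ := by ext; simp [mono]
  rw [this, pseudoExp_mono ht]
  simp [pseudoProb]

end MinKnapsack

/-! ### Degrees of the summands in a sum of squares -/

theorem Polynomial.degree_le_of_forall_eval_le {f g : Polynomial ℝ} (h0 : ∀ r, 0 ≤ f.eval r)
    (h : ∀ r, f.eval r ≤ g.eval r) : f.degree ≤ g.degree := by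
  by_contra! hlt
  have hf : f ≠ 0 := by rintro rfl; simp at hlt
  have h1 := Polynomial.isLittleO_atTop_of_degree_lt g f hlt
  -- Domination turns `g = o(f)` into `f = o(f)`.
  have h2 : (fun r => f.eval r) =o[Filter.atTop] fun r => f.eval r :=
    (Asymptotics.isBigO_of_le _ fun r => by
      rw [Real.norm_of_nonneg (h0 r), Real.norm_of_nonneg ((h0 r).trans (h r))]
      exact h r).trans_isLittleO h1
  have h3 := (Asymptotics.isLittleO_irrefl' (f' := fun r => f.eval r) (l := Filter.atTop)
    ((Polynomial.eventually_atTop_not_isRoot f hf).mono fun r hr => norm_ne_zero_iff.2 hr).frequently)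
  exact h3 h2

namespace MvPolynomial

theorem IsHomogeneous.eval_smul {σ R : Type*} [CommSemiring R] {p : MvPolynomial σ R} {k : ℕ}
    (hp : p.IsHomogeneous k) (r : R) (x : σ → R) : eval (r • x) p = r ^ k * eval x p := by
  rw [eval_eq, eval_eq, Finset.mul_sum]
  refine Finset.sum_congr rfl fun m hm => ?_
  have : m.sum (fun _ e => e) = k := by
    have := hp (mem_support_iff.1 hm)
    rwa [Finsupp.weight_apply, Finsupp.sum_congr (g2 := fun _ e => e) (by simp)] at this
  simp only [Pi.smul_apply, smul_eq_mul, mul_pow, Finset.prod_mul_distrib, Finset.prod_pow_eq_pow_sum]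
  rw [← this, Finsupp.sum]
  ring

/-- The restriction `r ↦ p (r x)` of a polynomial to the line through the origin and `x`. -/
noncomputable def lineRestrict {σ R : Type*} [CommSemiring R] (x : σ → R) (p : MvPolynomial σ R) :
    Polynomial R :=
  ∑ i ∈ Finset.range (p.totalDegree + 1),
    Polynomial.monomial i (eval x (homogeneousComponent i p))

theorem eval_lineRestrict {σ R : Type*} [CommSemiring R] (x : σ → R) (p : MvPolynomial σ R)
    (r : R) : (lineRestrict x p).eval r = eval (r • x) p := by
  conv_rhs => rw [← sum_homogeneousComponent p]
  rw [lineRestrict, Polynomial.eval_finsetSum, map_sum]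
  refine Finset.sum_congr rfl fun i _ => ?_
  rw [(homogeneousComponent_isHomogeneous i p).eval_smul, Polynomial.eval_monomial, mul_comm]

theorem degree_lineRestrict_le {σ R : Type*} [CommSemiring R] (x : σ → R) (p : MvPolynomial σ R) :
    (lineRestrict x p).degree ≤ p.totalDegree :=
  (Polynomial.degree_sum_le _ _).trans <| Finset.sup_le fun i hi =>
    (Polynomial.degree_monomial_le _ _).trans <| by
      exact_mod_cast Nat.lt_succ_iff.1 (Finset.mem_range.1 hi)

theorem coeff_totalDegree_lineRestrict {σ R : Type*} [CommSemiring R] (x : σ → R)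
    (p : MvPolynomial σ R) : (lineRestrict x p).coeff p.totalDegree =
      eval x (homogeneousComponent p.totalDegree p) := by
  simp [lineRestrict, Polynomial.finsetSum_coeff, Polynomial.coeff_monomial]

theorem homogeneousComponent_totalDegree_ne_zero {σ R : Type*} [CommSemiring R]
    {p : MvPolynomial σ R} (hp : p ≠ 0) : homogeneousComponent p.totalDegree p ≠ 0 := by
  obtain ⟨m, hm, hd⟩ := p.support.exists_mem_eq_sup (support_nonempty.2 hp)
    fun m => m.sum fun _ e => e
  intro h
  have h' := congrArg (coeff m) h
  rw [coeff_homogeneousComponent, if_pos, coeff_zero] at h'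
  · exact mem_support_iff.1 hm h'
  · rw [totalDegree, hd]; rfl

/-- Restrict to a line through the origin on which the top form of `f` does not vanish; this reduces
to one variable. -/
theorem totalDegree_le_of_forall_eval_le {σ : Type*} {f g : MvPolynomial σ ℝ}
    (h0 : ∀ x, 0 ≤ eval x f) (h : ∀ x, eval x f ≤ eval x g) : f.totalDegree ≤ g.totalDegree := by
  rcases eq_or_ne f 0 with rfl | hf
  · simp
  obtain ⟨x, hx⟩ : ∃ x, eval x (homogeneousComponent f.totalDegree f) ≠ 0 := by
    by_contra! hall
    exact homogeneousComponent_totalDegree_ne_zero hf (MvPolynomial.funext fun x => by simp [hall x])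
  have h1 : (f.totalDegree : WithBot ℕ) ≤ (lineRestrict x f).degree :=
    Polynomial.le_degree_of_ne_zero (by rwa [coeff_totalDegree_lineRestrict])
  have h2 := Polynomial.degree_le_of_forall_eval_le (f := lineRestrict x f) (g := lineRestrict x g)
    (fun r => by rw [eval_lineRestrict]; exact h0 _)
    (fun r => by rw [eval_lineRestrict, eval_lineRestrict]; exact h _)
  exact_mod_cast h1.trans (h2.trans (degree_lineRestrict_le x g))

theorem eval_nonneg_of_isSumSq {σ : Type*} {s : MvPolynomial σ ℝ} (hs : IsSumSq s) (x : σ → ℝ) :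
    0 ≤ eval x s := by
  induction hs with
  | zero => simp
  | sq_add a _ ih => rw [map_add, map_mul]; exact add_nonneg (mul_self_nonneg _) ih

/-- A sum of squares of degree at most `2D` is a sum of squares of polynomials of degree at
most `D`. -/
theorem isSumSq_induction_totalDegree {σ : Type*} {D : ℕ} {motive : MvPolynomial σ ℝ → Prop}
    (zero : motive 0)
    (sq_add : ∀ a s, a.totalDegree ≤ D → motive s → motive (a * a + s))
    {s : MvPolynomial σ ℝ} (hs : IsSumSq s) (hd : s.totalDegree ≤ 2 * D) : motive s := by
  induction hs with
  | zero => exact zero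
  | @sq_add a s hs ih =>
    -- Both summands are nonnegative, so the sum dominates each and leading terms cannot cancel.
    have h1 : (a * a).totalDegree ≤ (a * a + s).totalDegree :=
      totalDegree_le_of_forall_eval_le (fun x => by rw [map_mul]; exact mul_self_nonneg _)
        fun x => by rw [map_add]; linarith [eval_nonneg_of_isSumSq hs x]
    have h2 : s.totalDegree ≤ (a * a + s).totalDegree :=
      totalDegree_le_of_forall_eval_le (eval_nonneg_of_isSumSq hs)
        fun x => by rw [map_add, map_mul]; linarith [mul_self_nonneg (eval x a)]
    refine sq_add a s ?_ (ih (h2.trans hd))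
    rcases eq_or_ne a 0 with rfl | ha
    · simp
    · rw [totalDegree_mul_of_isDomain ha ha] at h1
      omega

end MvPolynomial

/-! ### Positivity on squares of low degree -/

namespace MinKnapsack

/-- The functions on `{0,1}^n` given by polynomials of degree at most `D`. -/
def monoSpan (n D : ℕ) : Submodule ℝ (Finset (Fin n) → ℝ) :=
  Submodule.span ℝ (mono '' {A | A.card ≤ D})

theorem mono_mem_monoSpan {n D : ℕ} {A : Finset (Fin n)} (h : A.card ≤ D) :
    mono A ∈ monoSpan n D :=
  Submodule.subset_span ⟨A, h, rfl⟩

theorem monoSpan_mono {n D E : ℕ} (h : D ≤ E) : monoSpan n D ≤ monoSpan n E :=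
  Submodule.span_mono (Set.image_mono fun _ hA => le_trans hA h)

theorem mul_mem_monoSpan {n D E : ℕ} {f g : Finset (Fin n) → ℝ} (hf : f ∈ monoSpan n D)
    (hg : g ∈ monoSpan n E) : f * g ∈ monoSpan n (D + E) := by
  have h := Submodule.mul_mem_mul hf hg
  rw [monoSpan, monoSpan, Submodule.span_mul_span] at h
  refine Submodule.span_mono ?_ h
  rintro _ ⟨_, ⟨A, hA, rfl⟩, _, ⟨B, hB, rfl⟩, rfl⟩
  exact ⟨A ∪ B, (Finset.card_union_le A B).trans (add_le_add hA hB), (mono_mul_mono A B).symm⟩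

theorem pseudoExp_gap_mul {n D : ℕ} {t : ℝ} (ht : ∀ k : ℕ, t ≠ k) (hD : D < n)
    {g : Finset (Fin n) → ℝ} (hg : g ∈ monoSpan n D) : pseudoExp n t (gap n t * g) = 0 := by
  suffices monoSpan n D ≤ LinearMap.ker (pseudoExp n t ∘ₗ LinearMap.mulLeft ℝ (gap n t)) from
    this hg
  refine Submodule.span_le.2 ?_
  rintro _ ⟨A, hA, rfl⟩
  refine pseudoExp_gap_mul_mono ht ?_
  rintro rfl
  simp at hA
  omega

/-- Modulo multiples of `t - |x|`, polynomials of degree at most `D + 1` are homogeneous. -/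
theorem exists_homogeneous_add_gap_mul {n D : ℕ} {t : ℝ} (ht : ∀ k : ℕ, t ≠ k)
    {g : Finset (Fin n) → ℝ} (hg : g ∈ monoSpan n (D + 1)) :
    ∃ f ∈ Submodule.span ℝ (mono '' {A : Finset (Fin n) | A.card = D + 1}),
      ∃ h ∈ monoSpan n D, f + gap n t * h = g := by
  set U := Submodule.span ℝ (mono '' {A : Finset (Fin n) | A.card = D + 1}) ⊔
    (monoSpan n D).map (LinearMap.mulLeft ℝ (gap n t))
  -- Modulo the gap, `x_A` is `1 / (t - |A|)` times the sum of the `x_{A ∪ {j}}`; iterate up to size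
  -- `D + 1`.
  have key : ∀ k, ∀ A : Finset (Fin n), A.card + k = D + 1 → mono A ∈ U := by
    intro k
    induction k with
    | zero => exact fun A hA => Submodule.mem_sup_left (Submodule.subset_span ⟨A, hA, rfl⟩)
    | succ k ih =>
      intro A hA
      have h1 : gap n t * mono A ∈ U :=
        Submodule.mem_sup_right ⟨mono A, mono_mem_monoSpan (by omega), rfl⟩
      have h2 : ∑ j ∈ Aᶜ, mono (insert j A) ∈ U := by
        refine Submodule.sum_mem _ fun j hj => ih _ ?_
        rw [Finset.card_insert_of_notMem (Finset.mem_compl.1 hj)]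
        omega
      have h3 : (t - A.card) • mono A ∈ U := by
        have := Submodule.add_mem _ h1 h2
        rwa [gap_mul_mono, sub_add_cancel] at this
      exact (Submodule.smul_mem_iff _ (sub_ne_zero.2 (ht _))).1 h3
  have hU : g ∈ U := by
    refine (Submodule.span_le.2 ?_ : monoSpan n (D + 1) ≤ U) hg
    rintro _ ⟨A, hA, rfl⟩
    exact key (D + 1 - A.card) A (Nat.add_sub_of_le hA)
  obtain ⟨f, hf, _, ⟨h, hh, rfl⟩, e⟩ := Submodule.mem_sup.1 hU
  exact ⟨f, hf, h, hh, e⟩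

theorem pseudoExp_mono_mul_mono {n D : ℕ} {t : ℝ} (ht : ∀ k : ℕ, t ≠ k) (hn : 2 * D ≤ n)
    {A B : Finset (Fin n)} (hA : A.card = D) (hB : B.card = D) :
    pseudoExp n t (mono A * mono B) = ∑ K ∈ Finset.univ.filter (fun K : Finset (Fin n) => K.card ≤ D),
      pseudoProb n t (2 * D - K.card) K.card * (mono K A * mono K B) := by
  have hs : (A ∩ B).card ≤ D := hA ▸ Finset.card_le_card Finset.inter_subset_left
  have hc : (A ∪ B).card = 2 * D - (A ∩ B).card := by
    have := Finset.card_union_add_card_inter A B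
    omega
  have e1 : ∑ K ∈ Finset.univ.filter (fun K : Finset (Fin n) => K.card ≤ D),
      pseudoProb n t (2 * D - K.card) K.card * (mono K A * mono K B) =
      ∑ K ∈ (A ∩ B).powerset, pseudoProb n t (2 * D - K.card) K.card := by
    rw [← Finset.sum_subset (s₁ := (A ∩ B).powerset)]
    · refine Finset.sum_congr rfl fun K hK => ?_
      have := Finset.subset_inter_iff.1 (Finset.mem_powerset.1 hK)
      simp [mono, this]
    · intro K hK
      simpa using (Finset.card_le_card (Finset.mem_powerset.1 hK)).trans hs
    · intro K _ hK
      rw [Finset.mem_powerset, Finset.subset_inter_iff, not_and_or] at hK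
      rcases hK with h | h <;> simp [mono, h]
  -- Expanding over `|A ∩ B|` coordinates produces the binomials that count the `K ⊆ A ∩ B` of each
  -- size.
  rw [e1, Finset.sum_powerset_apply_card (fun k => pseudoProb n t (2 * D - k) k),
    mono_mul_mono, pseudoExp_mono ht, hc, pseudoProb_expand t (A ∩ B).card _ _ (by omega)]
  refine Finset.sum_congr rfl fun j _ => ?_
  rw [nsmul_eq_mul, zero_add, Nat.sub_add_cancel (by omega)]

theorem pseudoExp_sq_nonneg_of_homogeneous {n D : ℕ} {t : ℝ} (ht : ∀ k : ℕ, t ≠ k)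
    (hn : 2 * D ≤ n) (h1 : (2 * D : ℝ) ≤ t + 1) (h2 : (D : ℝ) ≤ n - t + 1)
    {f : Finset (Fin n) → ℝ}
    (hf : f ∈ Submodule.span ℝ (mono '' {A : Finset (Fin n) | A.card = D})) :
    0 ≤ pseudoExp n t (f * f) := by
  set P := Finset.powersetCard D (Finset.univ : Finset (Fin n)) with hPdef
  have hset : {A : Finset (Fin n) | A.card = D} = ↑P := by
    ext; rw [hPdef]; simp [Finset.mem_powersetCard]
  rw [hset, Submodule.mem_span_image_finset_iff_exists_fun] at hf
  obtain ⟨c, rfl⟩ := hf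
  have hP : ∀ A : P, A.1.card = D := fun A => (Finset.mem_powersetCard.1 A.2).2
  have e : pseudoExp n t ((∑ A : P, c A • mono A.1) * ∑ A : P, c A • mono A.1) =
      ∑ K ∈ Finset.univ.filter (fun K : Finset (Fin n) => K.card ≤ D),
        pseudoProb n t (2 * D - K.card) K.card * (∑ A : P, c A * mono K A.1) ^ 2 := by
    simp only [sq, Finset.sum_mul_sum, map_sum]
    simp only [Finset.mul_sum]
    conv_rhs => rw [Finset.sum_comm]
    refine Finset.sum_congr rfl fun A _ => ?_
    conv_rhs => rw [Finset.sum_comm]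
    refine Finset.sum_congr rfl fun B _ => ?_
    rw [smul_mul_smul_comm, map_smul, pseudoExp_mono_mul_mono ht hn (hP A) (hP B), smul_eq_mul,
      Finset.mul_sum]
    exact Finset.sum_congr rfl fun K _ => by ring
  rw [e]
  refine Finset.sum_nonneg fun K hK => mul_nonneg (pseudoProb_nonneg ?_ ?_ ?_) (sq_nonneg _)
  · have := (Finset.mem_filter.1 hK).2; omega
  · refine le_trans ?_ h1
    exact_mod_cast Nat.sub_le _ _
  · refine le_trans ?_ h2
    exact_mod_cast (Finset.mem_filter.1 hK).2

theorem pseudoExp_sq_nonneg {n D : ℕ} {t : ℝ} (ht : ∀ k : ℕ, t ≠ k)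
    (hn : 2 * (D + 1) ≤ n) (h1 : (2 * D + 1 : ℝ) ≤ t) (h2 : (D : ℝ) ≤ n - t)
    {g : Finset (Fin n) → ℝ} (hg : g ∈ monoSpan n (D + 1)) :
    0 ≤ pseudoExp n t (g * g) := by
  obtain ⟨f, hf, h, hh, rfl⟩ := exists_homogeneous_add_gap_mul ht hg
  have hf' : f ∈ monoSpan n (D + 1) :=
    Submodule.span_mono (Set.image_mono (Set.ofPred_subset_ofPred.2 fun _ hA => hA.le)) hf
  -- The cofactor of the gap has degree at most `2D + 1 < n`, so its term vanishes.
  have e : (f + gap n t * h) * (f + gap n t * h) =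
      f * f + gap n t * (h * (f + gap n t * h + f)) := by ring
  rw [e, map_add, pseudoExp_gap_mul ht (by omega)
    (mul_mem_monoSpan hh (Submodule.add_mem _ hg hf')), add_zero]
  exact pseudoExp_sq_nonneg_of_homogeneous ht hn (by push_cast; linarith)
    (by push_cast; linarith) hf

/-! ### Bounding the feasible values by `q` -/

/-- The point of `{0,1}^n` with support `S`. -/
def point {n : ℕ} (S : Finset (Fin n)) : Fin n → ℝ := fun i => if i ∈ S then 1 else 0

theorem point_mem_cube {n : ℕ} (S : Finset (Fin n)) : point S ∈ cube n := fun i => by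
  by_cases h : i ∈ S <;> simp [point, h]

theorem weight_point {n : ℕ} (S : Finset (Fin n)) : weight (point S) = S.card := by
  simp [weight, point]

theorem exists_eq_point {n : ℕ} {x : Fin n → ℝ} (hx : x ∈ cube n) : ∃ S, x = point S := by
  refine ⟨Finset.univ.filter fun i => x i = 1, funext fun i => ?_⟩
  rcases hx i with h | h <;> simp [point, h]

/-- The restriction of a polynomial to `{0,1}^n`. -/
noncomputable def evalCube {n : ℕ} (p : MvPolynomial (Fin n) ℝ) : Finset (Fin n) → ℝ :=
  fun S => MvPolynomial.eval (point S) p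

/-- On the cube `x_i ^ k = x_i` for `k ≥ 1`, so a monomial reduces to its support. -/
theorem evalCube_mem_monoSpan {n : ℕ} (p : MvPolynomial (Fin n) ℝ) :
    evalCube p ∈ monoSpan n p.totalDegree := by
  have e : evalCube p = ∑ m ∈ p.support, p.coeff m • mono m.support := by
    ext S
    rw [evalCube, MvPolynomial.eval_eq, Finset.sum_apply]
    refine Finset.sum_congr rfl fun m _ => ?_
    rw [Pi.smul_apply, smul_eq_mul]
    congr 1
    by_cases h : m.support ⊆ S
    · rw [mono, if_pos h]
      exact Finset.prod_eq_one fun i hi => by simp [point, h hi]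
    · obtain ⟨i, hi, hS⟩ := Finset.not_subset.1 h
      rw [mono, if_neg h]
      exact Finset.prod_eq_zero hi (by simp [point, hS, Finsupp.mem_support_iff.1 hi])
  rw [e]
  refine Submodule.sum_mem _ fun m hm => Submodule.smul_mem _ _ (mono_mem_monoSpan ?_)
  refine le_trans ?_ (MvPolynomial.le_totalDegree hm)
  rw [Finset.card_eq_sum_ones]
  exact Finset.sum_le_sum fun i hi => Nat.one_le_iff_ne_zero.2 (Finsupp.mem_support_iff.1 hi)

theorem pseudoExp_evalCube_nonneg {n D : ℕ} {t : ℝ} (ht : ∀ k : ℕ, t ≠ k)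
    (hn : 2 * (D + 1) ≤ n) (h1 : (2 * D + 1 : ℝ) ≤ t) (h2 : (D : ℝ) ≤ n - t)
    {s : MvPolynomial (Fin n) ℝ} (hs : IsSumSq s) (hd : s.totalDegree ≤ 2 * (D + 1)) :
    0 ≤ pseudoExp n t (evalCube s) := by
  refine MvPolynomial.isSumSq_induction_totalDegree (D := D + 1)
    (motive := fun s => 0 ≤ pseudoExp n t (evalCube s)) ?_ ?_ hs hd
  · have : evalCube (0 : MvPolynomial (Fin n) ℝ) = 0 := by ext; simp [evalCube]
    simp [this]
  · intro a s ha ih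
    have : evalCube (a * a + s) = evalCube a * evalCube a + evalCube s := by ext; simp [evalCube]
    rw [this, map_add]
    exact add_nonneg (pseudoExp_sq_nonneg ht hn h1 h2
      (monoSpan_mono ha (evalCube_mem_monoSpan a))) ih

theorem le_of_sosFeasible {n d : ℕ} {q v : ℝ} (hq : ∀ k : ℕ, q ≠ k) (hn : 2 * (d + 1) ≤ n)
    (h1 : (2 * d + 1 : ℝ) ≤ q) (h2 : (d : ℝ) ≤ n - q) (h : SOSFeasible n q d v) : v ≤ q := by
  obtain ⟨s₀, s₁, hs₀, hs₁, hd₀, hd₁, h⟩ := h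
  have e : evalCube s₀ = (q - v) • 1 + gap n q * (evalCube s₁ - 1) := by
    ext S
    have := h (point S) (point_mem_cube S)
    rw [weight_point] at this
    simp only [evalCube, gap, Pi.add_apply, Pi.smul_apply, Pi.mul_apply, Pi.sub_apply,
      Pi.one_apply, smul_eq_mul]
    linear_combination -this
  have h3 := pseudoExp_evalCube_nonneg hq hn h1 h2 hs₀ hd₀
  have h4 : (1 : Finset (Fin n) → ℝ) ∈ monoSpan n (2 * d) := by
    have : (1 : Finset (Fin n) → ℝ) = mono ∅ := by ext; simp [mono]
    rw [this]; exact mono_mem_monoSpan (by simp)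
  rw [e, map_add, map_smul, pseudoExp_one hq, pseudoExp_gap_mul hq (D := 2 * d) (by omega)
    (Submodule.sub_mem _ (monoSpan_mono hd₁ (evalCube_mem_monoSpan s₁)) h4), smul_eq_mul] at h3
  linarith

/-- Covers `q < 1` as well: a genuine distribution on the all-zeros and all-ones points, with mean
weight `q`, kills a constant times `|x| - q`. -/
theorem le_of_sosFeasible_zero {n : ℕ} {q v : ℝ} (hq0 : 0 < q) (hqn : q < n)
    (h : SOSFeasible n q 0 v) : v ≤ q := by
  obtain ⟨s₀, s₁, hs₀, hs₁, hd₀, hd₁, h⟩ := h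
  obtain ⟨a, rfl⟩ : ∃ a, s₁ = MvPolynomial.C a :=
    ⟨_, MvPolynomial.totalDegree_eq_zero_iff_eq_C.1 (by omega)⟩
  have e0 := h _ (point_mem_cube ∅)
  have e1 := h _ (point_mem_cube Finset.univ)
  simp only [weight_point, Finset.card_empty, Finset.card_univ, Fintype.card_fin,
    MvPolynomial.eval_C, Nat.cast_zero] at e0 e1
  have p0 := MvPolynomial.eval_nonneg_of_isSumSq hs₀ (point ∅)
  have p1 := MvPolynomial.eval_nonneg_of_isSumSq hs₀ (point Finset.univ)
  have : 0 ≤ (n : ℝ) * (q - v) := by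
    have : (n : ℝ) * (q - v) = (n - q) * MvPolynomial.eval (point ∅) s₀ +
        q * MvPolynomial.eval (point Finset.univ) s₀ := by
      linear_combination (n - q) * e0 + q * e1
    rw [this]
    exact add_nonneg (mul_nonneg (by linarith) p0) (mul_nonneg hq0.le p1)
  linarith [nonneg_of_mul_nonneg_right this (hq0.trans hqn)]

/-! ### The optimal value, and exactness at degree `n` -/

theorem weight_ge_ceil {n : ℕ} {q : ℝ} {x : Fin n → ℝ} (hx : x ∈ cube n) (h : q ≤ weight x) :
    (⌈q⌉₊ : ℝ) ≤ weight x := by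
  obtain ⟨S, rfl⟩ := exists_eq_point hx
  rw [weight_point] at h ⊢
  exact_mod_cast Nat.ceil_le.2 h

theorem optVal_eq {n : ℕ} {q : ℝ} (hqn : q ≤ n) : optVal n q = ((⌈q⌉₊ : ℝ) : EReal) := by
  refine le_antisymm ?_ (le_iInf₂ fun x hx => EReal.coe_le_coe_iff.2 (weight_ge_ceil hx.1 hx.2))
  obtain ⟨S, -, hS⟩ := Finset.exists_subset_card_eq (s := (Finset.univ : Finset (Fin n)))
    (n := ⌈q⌉₊) (by simpa using hqn)
  refine (iInf₂_le (point S) ⟨point_mem_cube S, ?_⟩).trans_eq ?_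
  · rw [weight_point, hS]
  · rw [weight_point, hS]
    exact Nat.le_ceil q

theorem sosVal_ne_optVal {n d : ℕ} {q : ℝ} (hqn : q ≤ n) (hq : ∀ k : ℕ, q ≠ k)
    (h : ∀ v, SOSFeasible n q d v → v ≤ q) : sosVal n q d ≠ optVal n q := by
  rw [optVal_eq hqn]
  refine ne_of_lt (lt_of_le_of_lt (iSup₂_le fun v hv => EReal.coe_le_coe_iff.2 (h v hv)) ?_)
  exact EReal.coe_lt_coe_iff.2 (lt_of_le_of_ne (Nat.le_ceil q) (hq _))

theorem sosVal_le_optVal (n d : ℕ) (q : ℝ) : sosVal n q d ≤ optVal n q := by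
  refine iSup₂_le fun v hv => le_iInf₂ fun x hx => EReal.coe_le_coe_iff.2 ?_
  obtain ⟨s₀, s₁, hs₀, hs₁, -, -, h⟩ := hv
  have h1 := mul_nonneg (MvPolynomial.eval_nonneg_of_isSumSq hs₁ x) (sub_nonneg.2 hx.2)
  linarith [h x hx.1, MvPolynomial.eval_nonneg_of_isSumSq hs₀ x]

/-- Every nonnegative symmetric function on `{0,1}^n` is the square of a polynomial of degree at
most `n`. -/
theorem exists_sq_eval_point (n : ℕ) (φ : ℕ → ℝ) (hφ : ∀ k, 0 ≤ φ k) :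
    ∃ p : MvPolynomial (Fin n) ℝ, p.totalDegree ≤ n ∧
      ∀ S, MvPolynomial.eval (point S) (p * p) = φ S.card := by
  set P := Lagrange.interpolate (Finset.range (n + 1)) (fun k : ℕ => (k : ℝ)) fun k => √(φ k)
  have hinj : Set.InjOn (fun k : ℕ => (k : ℝ)) (Finset.range (n + 1)) := Nat.cast_injective.injOn
  have hP : P.natDegree ≤ n := by
    have := Lagrange.degree_interpolate_lt (fun k => √(φ k)) hinj
    rw [Finset.card_range] at this
    exact Polynomial.natDegree_le_iff_degree_le.2 (Order.le_of_lt_succ this)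
  refine ⟨Polynomial.aeval (∑ i, MvPolynomial.X i) P, ?_, fun S => ?_⟩
  · rw [Polynomial.aeval_eq_sum_range]
    refine (MvPolynomial.totalDegree_finsetSum _ _).trans (Finset.sup_le fun k hk => ?_)
    refine (MvPolynomial.totalDegree_smul_le _ _).trans ((MvPolynomial.totalDegree_pow _ _).trans ?_)
    have h1 : (∑ i, MvPolynomial.X i : MvPolynomial (Fin n) ℝ).totalDegree ≤ 1 :=
      (MvPolynomial.totalDegree_finsetSum _ _).trans (Finset.sup_le fun i _ => by simp)
    have h2 := Finset.mem_range.1 hk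
    nlinarith
  · have h1 : MvPolynomial.eval (point S) (Polynomial.aeval (∑ i, MvPolynomial.X i) P) =
        √(φ S.card) := by
      have hx : MvPolynomial.eval (point S) (∑ i, MvPolynomial.X i) = S.card := by
        rw [map_sum, ← weight_point]; simp [weight]
      have := Lagrange.eval_interpolate_at_node (fun k => √(φ k)) hinj (i := S.card)
        (by have := Finset.card_le_univ S; simp at this; simp; omega)
      rw [← this, ← hx, ← MvPolynomial.coe_aeval_eq_eval, RingHom.coe_coe,
        ← Polynomial.aeval_algHom_apply, Polynomial.coe_aeval_eq_eval]
    rw [map_mul, h1, Real.mul_self_sqrt (hφ _)]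

theorem sosVal_self_eq_optVal {n : ℕ} {q : ℝ} (hqn : q ≤ n) (hq : ∀ k : ℕ, q ≠ k) :
    sosVal n q n = optVal n q := by
  refine le_antisymm (sosVal_le_optVal n n q) ?_
  rw [optVal_eq hqn]
  refine le_iSup₂ (f := fun (v : ℝ) (_ : v ∈ {v : ℝ | SOSFeasible n q n v}) => (v : EReal)) _ ?_
  -- With `v = ⌈q⌉`, let `s₀` carry `|x| - v` on feasible points and `s₁` the nonnegative quotient
  -- on infeasible ones.
  obtain ⟨p₀, hd₀, h₀⟩ := exists_sq_eval_point n (fun k => if q ≤ k then (k : ℝ) - ⌈q⌉₊ else 0)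
    fun k => by
      split_ifs with h
      · have : (⌈q⌉₊ : ℝ) ≤ k := by exact_mod_cast Nat.ceil_le.2 h
        linarith
      · exact le_rfl
  obtain ⟨p₁, hd₁, h₁⟩ := exists_sq_eval_point n
    (fun k => if q ≤ k then 0 else ((k : ℝ) - ⌈q⌉₊) / (k - q)) fun k => by
      split_ifs with h
      · exact le_rfl
      · exact div_nonneg_of_nonpos (by linarith [Nat.le_ceil q]) (by linarith)
  refine ⟨p₀ * p₀, p₁ * p₁, IsSumSq.mul_self _, IsSumSq.mul_self _, ?_, ?_, fun x hx => ?_⟩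
  · have := MvPolynomial.totalDegree_mul p₀ p₀; omega
  · have := MvPolynomial.totalDegree_mul p₁ p₁; omega
  · obtain ⟨S, rfl⟩ := exists_eq_point hx
    rw [h₀, h₁, weight_point]
    split_ifs with h
    · ring
    · have := sub_ne_zero.2 (hq S.card).symm
      field_simp
      ring

end MinKnapsack

theorem mainTheorem5 :
    ∃ c : ℝ, 0 < c ∧
      ∀ (n : ℕ) (q : ℝ), 0 < q → q < (n : ℝ) → Int.fract q ≠ 0 →
        c * min (⌈q⌉ : ℝ) ((n : ℝ) - (⌊q⌋ : ℝ)) ≤ (MinKnapsack.sosRank n q : ℝ) := by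
  -- If `d ≥ 1` and `4d` is below the minimum, then `q` and `n - q` both exceed `4d - 1`, which
  -- yields all three hypotheses of `le_of_sosFeasible`.
  refine ⟨1 / 4, by norm_num, fun n q hq0 hqn hfr => ?_⟩
  have hq : ∀ k : ℕ, q ≠ k := by rintro k rfl; simp at hfr
  -- Exactness at degree `n` excludes the default `sInf ∅ = 0`.
  have hmem : MinKnapsack.sosVal n q (MinKnapsack.sosRank n q) = MinKnapsack.optVal n q :=
    Nat.sInf_mem (s := {d | MinKnapsack.sosVal n q d = MinKnapsack.optVal n q})
      ⟨n, MinKnapsack.sosVal_self_eq_optVal hqn.le hq⟩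
  set d := MinKnapsack.sosRank n q
  by_contra! hlt
  refine MinKnapsack.sosVal_ne_optVal hqn.le hq (fun v hv => ?_) hmem
  rcases Nat.eq_zero_or_pos d with h0 | hpos
  · rw [h0] at hv
    exact MinKnapsack.le_of_sosFeasible_zero hq0 hqn hv
  · have hd : (1 : ℝ) ≤ d := by exact_mod_cast hpos
    have hc := Int.ceil_lt_add_one q
    have hf := Int.lt_floor_add_one q
    have hm1 := min_le_left (⌈q⌉ : ℝ) ((n : ℝ) - (⌊q⌋ : ℝ))
    have hm2 := min_le_right (⌈q⌉ : ℝ) ((n : ℝ) - (⌊q⌋ : ℝ))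
    refine MinKnapsack.le_of_sosFeasible hq ?_ (by linarith) (by linarith) hv
    have : (2 * (d + 1) : ℝ) ≤ n := by linarith
    exact_mod_cast this
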